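/- **Setting.** A directed hypergraph $H=(V,E)$ has a finite vertex set $V=\{1,\dots,n\}$ and a nonempty finite set $E$ of directed edges. An edge $e$ is a subset of $V$ with a partition $e=T_e\sqcup H_e$ into a nonempty tail $T_e$ and a nonempty head $H_e$; distinct edges are distinct as subsets of $V$. The edges need not all have the same size. Let $d^+(i)=|\{e\in E: i\in T_e\}|$, let $\delta^+$ and $\Delta^+$ be the minimum and maximum of $d^+$ over $V$, and let $m=\max_{e\in E}|e|$ be the rank of $H$. The out-adjacency hypermatrix $A_H^+=(a^+_{p_1\dots p_m})$ has order $m$ and dimension $n$. For an edge $e$ with $|e|=s$ and $|T_e|=k$, put $a^+_{p_1\dots p_m}=k/\alpha$ whenever, for some $t$ with $k\le t\le m-s+k$, $\{p_1,\dots,p_t\}=T_e$ and $\{p_{t+1},\dots,p_m\}=H_e$, where $$\alpha=\sum_{r=0}^{m-s}\Bigl(\sum_{\substack{t_1,\dots,t_k\ge1\\ \sum t_i=r+k}}\frac{(r+k)!}{t_1!\cdots t_k!}\Bigr)\Bigl(\sum_{\substack{t_1,\dots,t_{s-k}\ge1\\ \sum t_i=m-k-r}}\frac{(m-k-r)!}{t_1!\cdots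 t_{s-k}!}\Bigr);$$ all other entries are $0$. Let $D_H^+$ be the diagonal hypermatrix of order $m$ with $d_{ii\dots i}=d^+(i)$, and let $\mathbb L_H^+=D_H^++A_H^+$. For a hypermatrix $A$ of order $m$ and dimension $n$, a pair $(\lambda,x)\in\mathbb C\times(\mathbb C^n\setminus\{0\})$ is an eigenpair, and $\lambda$ an eigenvalue, if $\sum_{i_2,\dots,i_m}a_{ii_2\dots i_m}x_{i_2}\cdots x_{i_m}=\lambda x_i^{m-1}$ for all $i$; $\lambda\in\mathbb R$ is an H-eigenvalue if it has a real eigenvector; $\rho(A)$ is the maximum of $|\lambda|$ over all eigenvalues. Let $\mathbf 1_i$ be the $i$-th standard basis vector. **Theorem.** Let $H$ be a directed hypergraph as above. 1. If $m\ge3$, then $(d^+(i),\mathbf 1_i)$ is an eigenpair of $\mathbb L_H^+$ for every vertex $i$ such that no edge with exactly two vertices has head $\{i\}$ (hence for every vertex, if every edge has at least three vertices). 2. The maximum $\rho(\mathbb L_H^+)$ exists, and $2\delta^+\le\rho(\mathbb L_H^+)\le2\Delta^+$. 3. Suppose $m\ge3$. The set of real eigenvalues of $\mathbb L_H^+$ has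 a minimum $\lambda_{\min}$ and a maximum $\lambda_{\max}$, and $0\le\lambda_{\min}$ and $\delta^+\le\Delta^+\le\lambda_{\max}\le2\Delta^+$. If moreover some vertex $i$ with $d^+(i)=\delta^+$ is such that no edge with exactly two vertices has head $\{i\}$ (in particular, if every edge has at least three vertices), then $0\le\lambda_{\min}\le\delta^+\le\Delta^+\le\lambda_{\max}\le2\Delta^+$. The same holds with the set of H-eigenvalues in place of the set of real eigenvalues. 4. If all edges have the same number $m$ of vertices, $m$ is even, and $\bigcap_{e\in E}e\neq\emptyset$, then $0$ is an eigenvalue of $\mathbb L_H^+$. 5. If $d^+(i)=k$ for every vertex $i$, then $2k$ is an eigenvalue of $\mathbb L_H^+$. -/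

import Mathlib

open Finset

/-- A real hypermatrix (tensor) of order `m` whose indices range over `V`. -/
abbrev Hypermatrix (V : Type*) (m : ℕ) : Type _ := (Fin m → V) → ℝ

namespace Hypermatrix

variable {V : Type*} [Fintype V] [DecidableEq V] {m : ℕ}

/-- The vector `A x` (also written `A x^{m-1}`): its `i`-th entry is the sum of
`a_{i i₂ … i_m} x_{i₂} ⋯ x_{i_m}` over all `i₂, …, i_m`, that is, over all index tuples
with first entry `i`. -/
noncomputable def apply (A : Hypermatrix V m) (x : V → ℂ) (i : V) : ℂ :=
  ∑ p : Fin m → V with ∀ j : Fin m, j.val = 0 → p j = i,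
    (A p : ℂ) * ∏ j : Fin m with j.val ≠ 0, x (p j)

/-- `(c, x)` is an eigenpair of `A`: `x ≠ 0` and `A x^{m-1} = c x^{[m-1]}`. -/
def IsEigenpair (A : Hypermatrix V m) (c : ℂ) (x : V → ℂ) : Prop :=
  x ≠ 0 ∧ ∀ i, A.apply x i = c * x i ^ (m - 1)

/-- `c` is an eigenvalue of `A`. -/
def IsEigenvalue (A : Hypermatrix V m) (c : ℂ) : Prop :=
  ∃ x : V → ℂ, A.IsEigenpair c x

/-- The real number `c` is an H-eigenvalue of `A`: it has a real eigenvector. -/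
def IsHEigenvalue (A : Hypermatrix V m) (c : ℝ) : Prop :=
  ∃ x : V → ℝ, A.IsEigenpair (c : ℂ) (fun i => (x i : ℂ))

/-- The set of absolute values of the eigenvalues of `A`. -/
def eigenvalueModuli (A : Hypermatrix V m) : Set ℝ :=
  {r | ∃ c : ℂ, A.IsEigenvalue c ∧ r = ‖c‖}

/-- The spectral radius `ρ(A)`. -/
noncomputable def spectralRadius (A : Hypermatrix V m) : ℝ :=
  sSup A.eigenvalueModuli

end Hypermatrix

/-- A directed hyperedge on `V`: a vertex set partitioned into a nonempty tail
and a nonempty head. -/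
structure DirectedEdge (V : Type*) where
  tail : Finset V
  head : Finset V
  tail_nonempty : tail.Nonempty
  head_nonempty : head.Nonempty
  disjoint : Disjoint tail head

namespace DirectedEdge

variable {V : Type*} [DecidableEq V]

/-- The set of all vertices of the edge. -/
def verts (e : DirectedEdge V) : Finset V := e.tail ∪ e.head

/-- `Σ N! / (t₁! ⋯ t_k!)` over all `t₁, …, t_k ≥ 1` with `t₁ + ⋯ + t_k = N`. -/
def positiveMultinomialSum (k N : ℕ) : ℕ :=
  ∑ t ∈ (Finset.univ : Finset (Fin k)).piAntidiag N with ∀ i, 1 ≤ t i,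
    Nat.multinomial Finset.univ t

/-- The normalizing constant `α` of an edge with `s` vertices, `k` of them in the tail,
in a hypergraph of rank `m`. -/
def alpha (m s k : ℕ) : ℕ :=
  ∑ r ∈ Finset.range (m - s + 1),
    positiveMultinomialSum k (r + k) * positiveMultinomialSum (s - k) (m - k - r)

/-- The index tuple `p = (p₁, …, p_m)` belongs to the edge `e`: for some `t` with
`k ≤ t ≤ m - s + k` (`s` the number of vertices of `e`, `k` of them in the tail) the
entries `p₁, …, p_t` are tail vertices and each tail vertex occurs among them, and
`p_{t+1}, …, p_m` are head vertices and each head vertex occurs among them. -/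
def Fits (e : DirectedEdge V) {m : ℕ} (p : Fin m → V) : Prop :=
  ∃ t ∈ Finset.Icc e.tail.card (m - e.verts.card + e.tail.card),
    (Finset.univ.filter fun j : Fin m => (j : ℕ) < t).image p = e.tail ∧
    (Finset.univ.filter fun j : Fin m => t ≤ (j : ℕ)).image p = e.head

instance (e : DirectedEdge V) {m : ℕ} (p : Fin m → V) : Decidable (e.Fits p) := by
  unfold Fits
  infer_instance

end DirectedEdge

/-- A (not necessarily uniform) directed hypergraph with vertex set `V`: a finite set of
directed edges, distinct edges having distinct vertex sets. -/
structure DirectedHypergraph (V : Type*) [DecidableEq V] where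
  edges : Finset (DirectedEdge V)
  verts_injOn : ∀ e ∈ edges, ∀ f ∈ edges, e.verts = f.verts → e = f

namespace DirectedHypergraph

variable {V : Type*} [DecidableEq V]

/-- The out-degree `d⁺(v)`: the number of edges with `v` in the tail. -/
def outDegree (H : DirectedHypergraph V) (v : V) : ℕ :=
  (H.edges.filter fun e => v ∈ e.tail).card

/-- The smallest out-degree `δ⁺`. -/
def minOutDegree [Fintype V] [Nonempty V] (H : DirectedHypergraph V) : ℕ :=
  Finset.univ.inf' Finset.univ_nonempty H.outDegree

/-- The largest out-degree `Δ⁺`. -/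
def maxOutDegree [Fintype V] [Nonempty V] (H : DirectedHypergraph V) : ℕ :=
  Finset.univ.sup' Finset.univ_nonempty H.outDegree

/-- The rank of `H`: the maximum cardinality of an edge. -/
def rank (H : DirectedHypergraph V) : ℕ :=
  H.edges.sup fun e => e.verts.card

/-- `H` is `m`-uniform: every edge has exactly `m` vertices. -/
def IsUniform (H : DirectedHypergraph V) (m : ℕ) : Prop :=
  ∀ e ∈ H.edges, e.verts.card = m

/-- `H` is `k`-out-regular: every vertex has out-degree `k`. -/
def IsOutRegular (H : DirectedHypergraph V) (k : ℕ) : Prop :=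
  ∀ v, H.outDegree v = k

/-- The out-adjacency hypermatrix, in order `m` (it is used for `m` the rank of `H`). The entry
at `p` is `k / α` for the edge to which `p` belongs, and zero if there is none. There is at
most one such edge, since the entries of `p` form its vertex set. -/
noncomputable def outAdjacency (H : DirectedHypergraph V) (m : ℕ) : Hypermatrix V m := fun p =>
  ∑ e ∈ H.edges,
    if e.Fits p then
      (e.tail.card : ℝ) / (DirectedEdge.alpha m e.verts.card e.tail.card : ℝ)
    else 0

/-- The out-degree hypermatrix, in order `m`: the diagonal hypermatrix with
diagonal entries `d⁺(i)`. -/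
noncomputable def outDegreeHypermatrix [Fintype V] (H : DirectedHypergraph V) (m : ℕ) :
    Hypermatrix V m := fun p =>
  ∑ i : V, if ∀ j, p j = i then (H.outDegree i : ℝ) else 0

/-- The out-signless Laplacian hypermatrix, whose order is the rank of `H`. -/
noncomputable def outSignlessLaplacian [Fintype V] (H : DirectedHypergraph V) :
    Hypermatrix V H.rank :=
  H.outDegreeHypermatrix H.rank + H.outAdjacency H.rank

/-- No edge with exactly two vertices has the vertex `i` as its head. -/
def NotTwoVertexHead (H : DirectedHypergraph V) (i : V) : Prop :=
  ∀ e ∈ H.edges, e.verts.card = 2 → e.head ≠ {i}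

end DirectedHypergraph

/-! The constant `α` counts the index tuples that fit an edge. Permuting the tail of an edge with
`k` tail vertices preserves these tuples, so each tail vertex comes first in `α / k` of them. The
weight `k / α` therefore makes row `i` of the out-adjacency hypermatrix sum to `d⁺(i)`.

Evaluating the eigenvalue equation at a coordinate of maximal modulus then gives a Gershgorin disc
with centre and radius both `d⁺(i)`. This yields `2Δ⁺` as an upper bound and excludes negative real
eigenvalues. Row `i` of the Laplacian applied to the all-ones vector is `2 d⁺(i)`, which settles the
out-regular case.

Lower bounds come from a Collatz–Wielandt principle (`exists_eigenvalue_ge`): for nonnegative `A`, a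
nonzero `x ≥ 0` with `c x^{[m-1]} ≤ A x` forces a real eigenvalue at least `c`. The all-ones vector
gives `2δ⁺`; a basis vector at a vertex of maximal out-degree gives `Δ⁺`. Extrema exist because the
eigenvalue set is compact. For the eigenvalue `0`, flip the sign of the all-ones vector at a vertex
common to all edges. -/

/-! ### Counting words with a prescribed image. -/

/-- The number of words over `κ` indexed by `ι` with prescribed letter multiplicities. -/
theorem card_filter_card_fiber_eq_multinomial {ι κ : Type*} [Fintype ι] [DecidableEq ι]
    [Fintype κ] [DecidableEq κ] (t : κ → ℕ) (ht : ∑ c, t c = Fintype.card ι) :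
    #{f : ι → κ | ∀ c, #{j | f j = c} = t c} = Nat.multinomial univ t := by
  have hmon : ∀ u : κ → ℕ, ∏ c, (MvPolynomial.X c : MvPolynomial κ ℕ) ^ u c =
      MvPolynomial.monomial (Finsupp.equivFunOnFinite.symm u) 1 := by
    intro u
    rw [MvPolynomial.monomial_eq, Finsupp.prod_fintype _ _ (by simp)]
    simp
  -- The same power is expanded over words and by the multinomial theorem; comparing coefficients of
  -- one monomial gives the count.
  have h1 : (∑ c, (MvPolynomial.X c : MvPolynomial κ ℕ)) ^ Fintype.card ι =
      ∑ f : ι → κ, ∏ c, (MvPolynomial.X c : MvPolynomial κ ℕ) ^ #{j | f j = c} := by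
    rw [← Finset.card_univ, ← Finset.prod_const, Finset.prod_univ_sum, Fintype.piFinset_univ]
    refine Finset.sum_congr rfl fun f _ => ?_
    rw [← Finset.prod_fiberwise (s := univ) (g := f)]
    refine Finset.prod_congr rfl fun c _ => ?_
    rw [Finset.prod_congr rfl (g := fun _ => MvPolynomial.X c) (by simp_all), Finset.prod_const]
  have h2 := Finset.sum_pow_eq_sum_piAntidiag (univ : Finset κ)
    (fun c => (MvPolynomial.X c : MvPolynomial κ ℕ)) (Fintype.card ι)
  rw [h1] at h2
  have h3 := congrArg (MvPolynomial.coeff (Finsupp.equivFunOnFinite.symm t)) h2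
  simp only [hmon, MvPolynomial.coeff_sum, MvPolynomial.coeff_monomial,
    EmbeddingLike.apply_eq_iff_eq, ← map_natCast (MvPolynomial.C : ℕ →+* MvPolynomial κ ℕ),
    MvPolynomial.coeff_C_mul] at h3
  simp only [mul_ite, mul_one, mul_zero, Finset.sum_ite_eq', mem_piAntidiag, ht] at h3
  simp only [Finset.sum_boole, Nat.cast_id, mem_univ, implies_true, and_self, if_true] at h3
  rw [← h3]
  simp only [funext_iff]

/-- Group maps by their fibre sizes: surjectivity means that all sizes are at least one. -/
theorem card_surjective_eq_positiveMultinomialSum {ι : Type*} [Fintype ι] [DecidableEq ι]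
    (k : ℕ) : #{f : ι → Fin k | Function.Surjective f} =
      DirectedEdge.positiveMultinomialSum k (Fintype.card ι) := by
  unfold DirectedEdge.positiveMultinomialSum
  rw [Finset.card_eq_sum_card_fiberwise (f := fun f c => #{j | f j = c})
    (t := {t ∈ (univ : Finset (Fin k)).piAntidiag (Fintype.card ι) | ∀ i, 1 ≤ t i})]
  · refine Finset.sum_congr rfl fun t ht => ?_
    simp only [mem_filter, mem_piAntidiag] at ht
    rw [← card_filter_card_fiber_eq_multinomial (ι := ι) t ht.1.1]
    congr 1
    ext f
    simp only [mem_filter, mem_univ, true_and, funext_iff, and_iff_right_iff_imp]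
    intro h c
    have := (h c).symm ▸ ht.2 c
    obtain ⟨j, hj⟩ := Finset.card_pos.1 this
    exact ⟨j, by simpa using hj⟩
  · intro f hf
    simp only [coe_filter, mem_univ, true_and, Set.mem_ofPred_eq, mem_piAntidiag, implies_true,
      and_true] at hf ⊢
    refine ⟨?_, fun c => ?_⟩
    · rw [← Finset.card_eq_sum_card_fiberwise (by simp), Finset.card_univ]
    · obtain ⟨j, hj⟩ := hf c
      exact Finset.card_pos.2 ⟨j, by simpa using hj⟩

theorem card_image_univ_eq {ι V : Type*} [Fintype ι] [DecidableEq ι] [Fintype V] [DecidableEq V]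
    (T : Finset V) : #{f : ι → V | univ.image f = T} =
      DirectedEdge.positiveMultinomialSum #T (Fintype.card ι) := by
  rw [← card_surjective_eq_positiveMultinomialSum]
  symm
  let e := T.equivFin.symm
  refine Finset.card_bij (fun g _ j => (e (g j) : V)) ?_ ?_ ?_
  · intro g hg
    simp only [mem_filter, mem_univ, true_and] at hg ⊢
    ext v
    simp only [mem_image, mem_univ, true_and]
    constructor
    · rintro ⟨j, rfl⟩
      exact (e (g j)).2
    · intro hv
      obtain ⟨j, hj⟩ := hg (e.symm ⟨v, hv⟩)
      exact ⟨j, by simp [hj]⟩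
  · intro g _ g' _ h
    funext j
    exact e.injective (Subtype.ext (congrFun h j))
  · intro f hf
    simp only [mem_filter, mem_univ, true_and] at hf
    have hm : ∀ j, f j ∈ T := fun j => hf ▸ mem_image_of_mem f (mem_univ j)
    refine ⟨fun j => e.symm ⟨f j, hm j⟩, ?_, by simp⟩
    simp only [mem_filter, mem_univ, true_and]
    intro c
    have : (e c : V) ∈ univ.image f := hf ▸ (e c).2
    obtain ⟨j, -, hj⟩ := mem_image.1 this
    exact ⟨j, by simp [hj]⟩

/-- The positions before `t` and from `t` on are filled independently, hence a product. -/
theorem card_image_filter_eq {V : Type*} [Fintype V] [DecidableEq V] {m t : ℕ} (ht : t ≤ m)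
    (T S : Finset V) :
    #{p : Fin m → V | (univ.filter fun j : Fin m => (j : ℕ) < t).image p = T ∧
        (univ.filter fun j : Fin m => t ≤ (j : ℕ)).image p = S} =
      DirectedEdge.positiveMultinomialSum #T t *
        DirectedEdge.positiveMultinomialSum #S (m - t) := by
  have hc : Fintype.card {j : Fin m // (j : ℕ) < t} = t := by
    rw [Fintype.card_subtype, Fin.card_filter_val_lt, min_eq_right ht]
  have hc' : Fintype.card {j : Fin m // ¬ (j : ℕ) < t} = m - t := by
    rw [Fintype.card_subtype_compl, hc, Fintype.card_fin]
  have h1 := card_image_univ_eq (ι := {j : Fin m // (j : ℕ) < t}) T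
  have h2 := card_image_univ_eq (ι := {j : Fin m // ¬ (j : ℕ) < t}) S
  rw [hc] at h1
  rw [hc'] at h2
  rw [← h1, ← h2, ← Finset.card_product]
  refine Finset.card_equiv (Equiv.piEquivPiSubtypeProd (fun j : Fin m => (j : ℕ) < t) fun _ => V)
    fun p => ?_
  simp only [mem_filter, mem_univ, true_and, mem_product, Equiv.piEquivPiSubtypeProd_apply]
  refine and_congr (Eq.congr_left ?_) (Eq.congr_left ?_) <;>
  · ext v
    simp

/-! ### Tuples of an edge and the constant `α`. -/

namespace DirectedEdge

theorem card_tail_pos {V : Type*} (e : DirectedEdge V) : 0 < #e.tail := e.tail_nonempty.card_pos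

theorem card_head_pos {V : Type*} (e : DirectedEdge V) : 0 < #e.head := e.head_nonempty.card_pos

variable {V : Type*} [DecidableEq V]

theorem card_verts (e : DirectedEdge V) : #e.verts = #e.tail + #e.head :=
  Finset.card_union_of_disjoint e.disjoint

theorem card_fits [Fintype V] (e : DirectedEdge V) {m : ℕ} (hm : #e.verts ≤ m) :
    #{p : Fin m → V | e.Fits p} = alpha m #e.verts #e.tail := by
  have hv := e.card_verts
  have hh := e.card_head_pos
  have hsplit : ({p : Fin m → V | e.Fits p} : Finset _) =
      (Finset.Icc #e.tail (m - #e.verts + #e.tail)).biUnion fun t =>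
        {p : Fin m → V | (univ.filter fun j : Fin m => (j : ℕ) < t).image p = e.tail ∧
          (univ.filter fun j : Fin m => t ≤ (j : ℕ)).image p = e.head} := by
    ext p
    simp only [mem_filter, mem_univ, true_and, mem_biUnion]
    rfl
  rw [hsplit, Finset.card_biUnion]
  · refine Finset.sum_bij' (fun t _ => t - #e.tail) (fun r _ => r + #e.tail) ?_ ?_ ?_ ?_ ?_
    · intro t ht
      simp only [mem_Icc, mem_range] at ht ⊢
      omega
    · intro r hr
      simp only [mem_Icc, mem_range] at hr ⊢
      omega
    · intro t ht
      simp only [mem_Icc] at ht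
      omega
    · intro r _
      simp
    · intro t ht
      simp only [mem_Icc] at ht
      rw [card_image_filter_eq (by omega), Nat.sub_add_cancel ht.1,
        show m - #e.tail - (t - #e.tail) = m - t by omega, hv, Nat.add_sub_cancel_left]
  -- The cut `t` is determined by `p`: for cuts `t < t'`, the entry at position `t` would lie in
  -- both head and tail.
  · have key : ∀ t ∈ Icc #e.tail (m - #e.verts + #e.tail),
        ∀ t' ∈ Icc #e.tail (m - #e.verts + #e.tail), t < t' → ∀ p : Fin m → V,
        (univ.filter fun j : Fin m => t ≤ (j : ℕ)).image p = e.head →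
        (univ.filter fun j : Fin m => (j : ℕ) < t').image p = e.tail → False := by
      intro t ht t' ht' hlt p h1 h2
      simp only [mem_Icc] at ht ht'
      have htm : t < m := by omega
      have hd : p ⟨t, htm⟩ ∉ e.head :=
        Finset.disjoint_left.1 e.disjoint (h2 ▸ mem_image_of_mem p (by simpa using hlt))
      exact hd (h1 ▸ mem_image_of_mem p (by simp))
    intro t ht t' ht' hne
    rw [Function.onFun, Finset.disjoint_left]
    intro p hp hp'
    simp only [mem_filter, mem_univ, true_and] at hp hp'
    rcases lt_or_gt_of_ne hne with h | h
    · exact key t ht t' ht' h p hp.2 hp'.1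
    · exact key t' ht' t ht h p hp'.2 hp.1

theorem Fits.apply_zero_mem_tail {e : DirectedEdge V} {m : ℕ} {p : Fin m → V} (h : e.Fits p)
    {z : Fin m} (hz : (z : ℕ) = 0) : p z ∈ e.tail := by
  obtain ⟨t, ht, h1, -⟩ := h
  have := e.card_tail_pos
  rw [mem_Icc] at ht
  rw [← h1]
  exact mem_image_of_mem p (by simp; omega)

theorem Fits.comp_perm {e : DirectedEdge V} {m : ℕ} {p : Fin m → V} (h : e.Fits p)
    {σ : Equiv.Perm V} (ht : e.tail.image σ = e.tail) (hh : e.head.image σ = e.head) :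
    e.Fits (σ ∘ p) := by
  obtain ⟨t, htm, h1, h2⟩ := h
  exact ⟨t, htm, by rw [← Finset.image_image, h1, ht], by rw [← Finset.image_image, h2, hh]⟩

theorem image_swap_eq {T : Finset V} {i j : V} (h : i ∈ T ↔ j ∈ T) :
    T.image (Equiv.swap i j) = T := by
  ext v
  simp only [mem_image]
  constructor
  · rintro ⟨w, hw, rfl⟩
    rw [Equiv.swap_apply_def]
    split_ifs <;> simp_all
  · intro hv
    refine ⟨Equiv.swap i j v, ?_, by simp⟩
    rw [Equiv.swap_apply_def]
    split_ifs <;> simp_all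

/-- Swapping `i` and `j` in the values fixes tail and head as sets, so it injects one family into
the other. -/
theorem card_fits_first_le [Fintype V] (e : DirectedEdge V) {m : ℕ} (z : Fin m) {i j : V}
    (hi : i ∈ e.tail) (hj : j ∈ e.tail) :
    #{p : Fin m → V | e.Fits p ∧ p z = i} ≤ #{p : Fin m → V | e.Fits p ∧ p z = j} := by
  have hi' : i ∉ e.head := Finset.disjoint_left.1 e.disjoint hi
  have hj' : j ∉ e.head := Finset.disjoint_left.1 e.disjoint hj
  refine Finset.card_le_card_of_injOn (fun p => Equiv.swap i j ∘ p) ?_ ?_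
  · intro p hp
    simp only [coe_filter, mem_univ, true_and, Set.mem_ofPred_eq] at hp ⊢
    exact ⟨hp.1.comp_perm (image_swap_eq (by simp [hi, hj])) (image_swap_eq (by simp [hi', hj'])),
      by simp [hp.2]⟩
  · intro p _ q _ h
    exact (Equiv.swap i j).injective.comp_left h

/-- Each tail vertex is the first entry of the same number of tuples of an edge. -/
theorem card_tail_mul_card_fits_first [Fintype V] (e : DirectedEdge V) {m : ℕ}
    (hm : #e.verts ≤ m) {z : Fin m} (hz : (z : ℕ) = 0) {i : V} (hi : i ∈ e.tail) :
    #e.tail * #{p : Fin m → V | e.Fits p ∧ p z = i} = alpha m #e.verts #e.tail := by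
  rw [← e.card_fits hm, Finset.card_eq_sum_card_fiberwise (f := fun p : Fin m → V => p z)
    (t := e.tail) (fun p hp => Fits.apply_zero_mem_tail (Finset.mem_filter.1 hp).2 hz), ← smul_eq_mul,
    ← Finset.sum_const]
  refine Finset.sum_congr rfl fun j hj => ?_
  rw [Finset.filter_filter]
  exact (e.card_fits_first_le z hi hj).antisymm (e.card_fits_first_le z hj hi)

theorem positiveMultinomialSum_pos {k N : ℕ} (hk : 0 < k) (hN : k ≤ N) :
    0 < positiveMultinomialSum k N := by
  have h := card_surjective_eq_positiveMultinomialSum (ι := Fin N) k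
  rw [Fintype.card_fin] at h
  rw [← h, Finset.card_pos]
  refine ⟨fun j => if h : (j : ℕ) < k then ⟨j, h⟩ else ⟨0, hk⟩, ?_⟩
  simp only [mem_filter, mem_univ, true_and]
  intro c
  exact ⟨⟨c, c.2.trans_le hN⟩, by simp⟩

theorem alpha_pos (e : DirectedEdge V) {m : ℕ} (hm : #e.verts ≤ m) :
    0 < alpha m #e.verts #e.tail := by
  have hv := e.card_verts
  have hh := e.card_head_pos
  refine Finset.sum_pos (fun r hr => ?_) ⟨0, by simp⟩
  rw [mem_range] at hr
  exact Nat.mul_pos (positiveMultinomialSum_pos e.card_tail_pos (by omega))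
    (positiveMultinomialSum_pos (by omega) (by omega))

/-- A tail vertex starts `α / k` tuples of weight `k / α`; a vertex outside the tail starts none. -/
theorem sum_fits_first [Fintype V] (e : DirectedEdge V) {m : ℕ} (hm : #e.verts ≤ m)
    {z : Fin m} (hz : (z : ℕ) = 0) (i : V) :
    (∑ p : Fin m → V with p z = i,
      if e.Fits p then (#e.tail : ℝ) / (alpha m #e.verts #e.tail : ℝ) else 0) =
      if i ∈ e.tail then 1 else 0 := by
  rw [← Finset.sum_filter, Finset.filter_filter, Finset.sum_const, nsmul_eq_mul]
  split_ifs with hi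
  · have h := e.card_tail_mul_card_fits_first hm hz hi
    have hα : (alpha m #e.verts #e.tail : ℝ) ≠ 0 := by exact_mod_cast (e.alpha_pos hm).ne'
    rw [mul_div_assoc', div_eq_one_iff_eq hα, ← h]
    simp only [and_comm]
    push_cast
    ring
  · rw [Finset.card_eq_zero.2, Nat.cast_zero, zero_mul]
    refine Finset.filter_eq_empty_iff.2 fun p _ hp => hi ?_
    exact hp.1 ▸ hp.2.apply_zero_mem_tail hz

end DirectedEdge

/-! ### Row sums of the out-adjacency hypermatrix. -/

namespace DirectedHypergraph

variable {V : Type*} [DecidableEq V]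

theorem card_verts_le_rank (H : DirectedHypergraph V) {e : DirectedEdge V} (he : e ∈ H.edges) :
    #e.verts ≤ H.rank :=
  Finset.le_sup (f := fun e : DirectedEdge V => #e.verts) he

theorem two_le_rank {H : DirectedHypergraph V} (hE : H.edges.Nonempty) : 2 ≤ H.rank := by
  obtain ⟨e, he⟩ := hE
  have := H.card_verts_le_rank he
  have := e.card_verts
  have := e.card_tail_pos
  have := e.card_head_pos
  omega

theorem outAdjacency_nonneg (H : DirectedHypergraph V) {m : ℕ} (p : Fin m → V) :
    0 ≤ H.outAdjacency m p :=
  Finset.sum_nonneg fun e _ => by split_ifs <;> positivity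

/-- The row sums of the out-adjacency hypermatrix are the out-degrees. -/
theorem sum_outAdjacency [Fintype V] (H : DirectedHypergraph V)
    {z : Fin H.rank} (hz : (z : ℕ) = 0) (i : V) :
    ∑ p : Fin H.rank → V with p z = i, H.outAdjacency H.rank p = H.outDegree i := by
  simp only [outAdjacency]
  rw [Finset.sum_comm, Finset.sum_congr rfl fun e he =>
    e.sum_fits_first (H.card_verts_le_rank he) hz i]
  simp [outDegree]

theorem exists_fits_of_outAdjacency_ne_zero {H : DirectedHypergraph V} {m : ℕ} {p : Fin m → V}
    (h : H.outAdjacency m p ≠ 0) : ∃ e ∈ H.edges, e.Fits p := by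
  obtain ⟨e, he, hne⟩ := Finset.exists_ne_zero_of_sum_ne_zero h
  exact ⟨e, he, by by_contra hf; simp [hf] at hne⟩

end DirectedHypergraph

/-! ### Eigenvalue sets over `ℝ` and `ℂ` at once, and their compactness. -/

namespace Hypermatrix

theorem card_filter_val_ne_zero (m : ℕ) : #{j : Fin m | (j : ℕ) ≠ 0} = m - 1 := by
  cases m with
  | zero => simp
  | succ n => simp [Fin.val_eq_zero_iff, Finset.filter_ne']

theorem exists_norm_eq {V 𝕜 : Type*} [Fintype V] [Nonempty V] [SeminormedAddGroup 𝕜] (x : V → 𝕜) :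
    ∃ i, ‖x i‖ = ‖x‖ := by
  obtain ⟨i, hi⟩ := Finite.exists_max fun i => ‖x i‖
  exact ⟨i, (norm_le_pi_norm x i).antisymm ((pi_norm_le_iff_of_nonneg (norm_nonneg _)).2 hi)⟩

variable {V : Type*} [Fintype V] [DecidableEq V] {m : ℕ}
variable {𝕜 : Type*} [NormedField 𝕜] [NormedAlgebra ℝ 𝕜]

/-- The vector `A x^{m-1}` over an arbitrary normed field extension of `ℝ`. -/
noncomputable def applyOver (A : Hypermatrix V m) (x : V → 𝕜) (i : V) : 𝕜 :=
  ∑ p : Fin m → V with ∀ j : Fin m, j.val = 0 → p j = i,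
    A p • ∏ j : Fin m with j.val ≠ 0, x (p j)

theorem applyOver_complex (A : Hypermatrix V m) (x : V → ℂ) (i : V) :
    A.applyOver x i = A.apply x i := by
  simp [applyOver, apply]

theorem apply_ofReal (A : Hypermatrix V m) (x : V → ℝ) (i : V) :
    A.apply (fun j => (x j : ℂ)) i = (A.applyOver x i : ℝ) := by
  simp [applyOver, apply]

theorem applyOver_smul (A : Hypermatrix V m) (r : ℝ) (x : V → 𝕜) (i : V) :
    A.applyOver (r • x) i = r ^ (m - 1) • A.applyOver x i := by
  simp only [applyOver, Finset.smul_sum]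
  refine Finset.sum_congr rfl fun p _ => ?_
  simp only [Pi.smul_apply, Finset.prod_smul, Finset.prod_const, card_filter_val_ne_zero]
  rw [smul_comm]

theorem applyOver_add (A B : Hypermatrix V m) (x : V → 𝕜) (i : V) :
    (A + B).applyOver x i = A.applyOver x i + B.applyOver x i := by
  simp [applyOver, add_smul, Finset.sum_add_distrib]

/-- Continuity is joint in the hypermatrix and the vector because the hypermatrix is perturbed in
`exists_eigenvalue_ge`. -/
theorem continuous_applyOver (i : V) :
    Continuous fun q : Hypermatrix V m × (V → 𝕜) => q.1.applyOver q.2 i := by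
  unfold applyOver
  fun_prop

theorem norm_applyOver_le (A : Hypermatrix V m) {x : V → 𝕜} {M : ℝ} (hx : ∀ j, ‖x j‖ ≤ M) (i : V) :
    ‖A.applyOver x i‖ ≤
      (∑ p : Fin m → V with ∀ j : Fin m, j.val = 0 → p j = i, |A p|) * M ^ (m - 1) := by
  rw [applyOver, Finset.sum_mul]
  refine (norm_sum_le _ _).trans (Finset.sum_le_sum fun p _ => ?_)
  rw [norm_smul, Real.norm_eq_abs, ← card_filter_val_ne_zero m, ← Finset.prod_const, norm_prod]
  gcongr
  exact hx _

variable (𝕜) in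
/-- The eigenvalues of `A` over `𝕜`. -/
def eigenvalueSet (A : Hypermatrix V m) : Set 𝕜 :=
  {c | ∃ x : V → 𝕜, x ≠ 0 ∧ ∀ i, A.applyOver x i = c * x i ^ (m - 1)}

theorem isEigenvalue_iff (A : Hypermatrix V m) (c : ℂ) :
    A.IsEigenvalue c ↔ c ∈ A.eigenvalueSet ℂ := by
  simp only [IsEigenvalue, IsEigenpair, eigenvalueSet, applyOver_complex, Set.mem_ofPred_eq]

theorem isHEigenvalue_iff (A : Hypermatrix V m) (c : ℝ) :
    A.IsHEigenvalue c ↔ c ∈ A.eigenvalueSet ℝ := by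
  simp only [IsHEigenvalue, IsEigenpair, eigenvalueSet, apply_ofReal, Set.mem_ofPred_eq]
  refine exists_congr fun x => and_congr (not_congr ?_) (forall_congr' fun i => by norm_cast)
  simp [funext_iff]

theorem ofReal_mem_eigenvalueSet {A : Hypermatrix V m} {c : ℝ} (h : c ∈ A.eigenvalueSet ℝ) :
    (c : ℂ) ∈ A.eigenvalueSet ℂ := by
  rw [← isHEigenvalue_iff] at h
  rw [← isEigenvalue_iff]
  obtain ⟨x, hx⟩ := h
  exact ⟨_, hx⟩

/-- Both sides of the equation are homogeneous of degree `m - 1`, so eigenvectors can be taken on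
the compact unit sphere. -/
theorem mem_eigenvalueSet_iff_norm_eq_one {A : Hypermatrix V m} {c : 𝕜} :
    c ∈ A.eigenvalueSet 𝕜 ↔
      ∃ x : V → 𝕜, ‖x‖ = 1 ∧ ∀ i, A.applyOver x i = c * x i ^ (m - 1) := by
  constructor
  · rintro ⟨x, hx, h⟩
    refine ⟨(‖x‖⁻¹ : ℝ) • x, ?_, fun i => ?_⟩
    · rw [norm_smul, norm_inv, norm_norm, inv_mul_cancel₀ (norm_ne_zero_iff.2 hx)]
    · rw [applyOver_smul, h, Pi.smul_apply, smul_pow, mul_smul_comm]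
  · rintro ⟨x, hx, h⟩
    exact ⟨x, by rintro rfl; simp at hx, h⟩

/-- The set is the projection of a closed set of pairs in sphere times ball; the radius comes from a
coordinate of modulus one. -/
theorem isCompact_eigenvalueSet [Nonempty V] [ProperSpace 𝕜] (A : Hypermatrix V m) :
    IsCompact (A.eigenvalueSet 𝕜) := by
  have hK : IsCompact (Metric.sphere (0 : V → 𝕜) 1 ×ˢ Metric.closedBall (0 : 𝕜) (∑ p, |A p|)) :=
    (isCompact_sphere _ _).prod (isCompact_closedBall _ _)
  have hC : IsClosed {q : (V → 𝕜) × 𝕜 | ∀ i, A.applyOver q.1 i = q.2 * q.1 i ^ (m - 1)} := by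
    simp only [Set.ofPred_forall]
    refine isClosed_iInter fun i => isClosed_eq ?_ (by fun_prop)
    exact (continuous_applyOver i).comp (continuous_const.prodMk continuous_fst)
  convert (hK.inter_right hC).image continuous_snd
  ext c
  rw [mem_eigenvalueSet_iff_norm_eq_one]
  constructor
  · rintro ⟨x, hx, h⟩
    refine ⟨(x, c), ⟨⟨by simpa using hx, ?_⟩, h⟩, rfl⟩
    obtain ⟨i, hi⟩ := exists_norm_eq x
    have h1 := A.norm_applyOver_le (fun j => norm_le_pi_norm x j) i
    rw [h i, norm_mul, norm_pow, hi, hx, one_pow, mul_one, mul_one] at h1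
    rw [mem_closedBall_zero_iff]
    exact h1.trans (Finset.sum_le_sum_of_subset_of_nonneg (by simp) fun _ _ _ => abs_nonneg _)
  · rintro ⟨⟨x, c'⟩, ⟨⟨hx, -⟩, h⟩, rfl⟩
    exact ⟨x, by simpa using hx, h⟩

/-! ### Collatz–Wielandt principle for nonnegative hypermatrices. -/

theorem applyOver_nonneg {A : Hypermatrix V m} (hA : ∀ p, 0 ≤ A p) {x : V → ℝ}
    (hx : ∀ j, 0 ≤ x j) (i : V) : 0 ≤ A.applyOver x i :=
  Finset.sum_nonneg fun p _ => smul_nonneg (hA p) (Finset.prod_nonneg fun _ _ => hx _)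

/-- Every term grows weakly, and the term of the tuple `(i, k, …, k)` grows strictly. -/
theorem applyOver_lt {A : Hypermatrix V m} (hA : ∀ p, 0 < A p) (hm : m - 1 ≠ 0) {x y : V → ℝ}
    (hx : ∀ j, 0 ≤ x j) (hxy : ∀ j, x j ≤ y j) {k : V} (hk : x k < y k) (i : V) :
    A.applyOver x i < A.applyOver y i := by
  refine Finset.sum_lt_sum (fun p _ => smul_le_smul_of_nonneg_left
    (Finset.prod_le_prod (fun _ _ => hx _) fun _ _ => hxy _) (hA p).le)
    ⟨fun j => if j.val = 0 then i else k, by simp +contextual, ?_⟩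
  refine smul_lt_smul_of_pos_left ?_ (hA _)
  have : ∀ z : V → ℝ, ∏ j : Fin m with j.val ≠ 0, z (if j.val = 0 then i else k) =
      z k ^ (m - 1) := by
    intro z
    rw [← card_filter_val_ne_zero m, ← Finset.prod_const]
    exact Finset.prod_congr rfl fun j hj => by rw [if_neg (Finset.mem_filter.1 hj).2]
  rw [this, this]
  exact pow_lt_pow_left₀ hk (hx k) hm

theorem le_sum_of_subeigenvector [Nonempty V] {A : Hypermatrix V m} (hA : ∀ p, 0 ≤ A p) {x : V → ℝ}
    (hx : ∀ j, 0 ≤ x j) (hx1 : ‖x‖ = 1) {c : ℝ} (h : ∀ i, c * x i ^ (m - 1) ≤ A.applyOver x i) :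
    c ≤ ∑ p, A p := by
  obtain ⟨i, hi⟩ := exists_norm_eq x
  have h1 := A.norm_applyOver_le (fun j => norm_le_pi_norm x j) i
  have h2 := h i
  rw [hx1, Real.norm_of_nonneg (hx i)] at hi
  rw [hi, one_pow, mul_one] at h2
  rw [hx1, one_pow, mul_one] at h1
  refine h2.trans ((le_abs_self _).trans (h1.trans ?_))
  simp only [abs_of_nonneg (hA _)]
  exact Finset.sum_le_sum_of_subset_of_nonneg (by simp) fun _ _ _ => hA _

theorem normalize_subeigenvector {A : Hypermatrix V m} {x : V → ℝ}
    (hx : ∀ j, 0 ≤ x j) (hx0 : x ≠ 0) {c : ℝ} (h : ∀ i, c * x i ^ (m - 1) ≤ A.applyOver x i) :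
    ∃ y : V → ℝ, (∀ j, 0 ≤ y j) ∧ ‖y‖ = 1 ∧ ∀ i, c * y i ^ (m - 1) ≤ A.applyOver y i := by
  refine ⟨(‖x‖⁻¹ : ℝ) • x, fun j => mul_nonneg (by positivity) (hx j), ?_, fun i => ?_⟩
  · rw [norm_smul, norm_inv, norm_norm, inv_mul_cancel₀ (norm_ne_zero_iff.2 hx0)]
  · rw [applyOver_smul, Pi.smul_apply, smul_pow, mul_smul_comm]
    exact smul_le_smul_of_nonneg_left (h i) (by positivity)

/-- A subeigenvector of a positive hypermatrix which is not an eigenvector can be improved. -/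
theorem exists_lt_subeigenvector [Nonempty V] {A : Hypermatrix V m} (hA : ∀ p, 0 < A p)
    (hm : m - 1 ≠ 0) {x : V → ℝ} (hx : ∀ j, 0 ≤ x j) (hx0 : x ≠ 0) {c : ℝ} (hc : 0 ≤ c)
    (h : ∀ i, c * x i ^ (m - 1) ≤ A.applyOver x i) {k : V}
    (hk : c * x k ^ (m - 1) < A.applyOver x k) :
    ∃ c' > c, ∃ y : V → ℝ, (∀ j, 0 ≤ y j) ∧ y ≠ 0 ∧
      ∀ i, c' * y i ^ (m - 1) ≤ A.applyOver y i := by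
  have hpos : ∀ i, 0 < A.applyOver x i := by
    intro i
    obtain ⟨j, hj⟩ : ∃ j, x j ≠ 0 := by
      by_contra! h0
      exact hx0 (funext h0)
    have h1 := applyOver_lt hA hm (x := 0) (fun _ => le_rfl) hx ((hx j).lt_of_ne' hj) i
    exact (applyOver_nonneg (fun p => (hA p).le) (fun _ => le_rfl) i).trans_lt h1
  have hroot : ∀ a : ℝ, 0 ≤ a → ∃ b, 0 ≤ b ∧ b ^ (m - 1) = a := fun a ha =>
    ⟨a ^ (((m - 1 : ℕ) : ℝ)⁻¹), by positivity, Real.rpow_inv_natCast_pow ha hm⟩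
  -- One step of the power method: `y ^ (m - 1) = A x` coordinatewise and `s ^ (m - 1) = c`. Then `s
  -- • x ≤ y`, strictly at `k`, so positivity of `A` makes `A y` exceed `A (s • x) = c y ^ (m - 1)`
  -- in every coordinate.
  obtain ⟨s, hs0, hs⟩ := hroot c hc
  choose y hy0 hy using fun i => hroot (A.applyOver x i) (hpos i).le
  have hypos : ∀ i, 0 < y i := fun i => by
    refine (hy0 i).lt_of_ne' fun h0 => (hpos i).ne' ?_
    rw [← hy, h0, zero_pow hm]
  have hle : ∀ i, (s • x) i ≤ y i := fun i => by
    refine le_of_pow_le_pow_left₀ hm (hy0 i) ?_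
    rw [Pi.smul_apply, smul_pow, hs, hy]
    exact h i
  have hlt : (s • x) k < y k := by
    refine lt_of_pow_lt_pow_left₀ (m - 1) (hy0 k) ?_
    rw [Pi.smul_apply, smul_pow, hs, hy]
    exact hk
  have hstrict : ∀ i, c * y i ^ (m - 1) < A.applyOver y i := fun i => by
    have h1 := applyOver_lt hA hm (x := s • x) (fun j => mul_nonneg hs0 (hx j)) hle hlt i
    rwa [applyOver_smul, hs, ← hy, smul_eq_mul] at h1
  -- The improved constant is the least of the ratios, all of which exceed `c`.
  obtain ⟨i₀, hi₀⟩ := Finite.exists_min fun i => A.applyOver y i / y i ^ (m - 1)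
  refine ⟨A.applyOver y i₀ / y i₀ ^ (m - 1), ?_, y, hy0, fun h0 => ?_, fun i => ?_⟩
  · exact (lt_div_iff₀ (pow_pos (hypos _) _)).2 (hstrict i₀)
  · exact (hypos k).ne' (congrFun h0 k)
  · exact (le_div_iff₀ (pow_pos (hypos _) _)).1 (hi₀ i)

/-- Collatz–Wielandt for positive hypermatrices. -/
theorem exists_eigenvalue_ge_of_pos [Nonempty V] {A : Hypermatrix V m} (hA : ∀ p, 0 < A p)
    (hm : m - 1 ≠ 0) {x : V → ℝ} (hx : ∀ j, 0 ≤ x j) (hx0 : x ≠ 0) {c : ℝ} (hc : 0 ≤ c)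
    (h : ∀ i, c * x i ^ (m - 1) ≤ A.applyOver x i) :
    ∃ c' ≥ c, c' ∈ A.eigenvalueSet ℝ := by
  have hA' : ∀ p, 0 ≤ A p := fun p => (hA p).le
  -- Maximise `d` over the compact set of normalised nonnegative subeigenpairs; a strict inequality
  -- at the maximum could be improved.
  let K : Set ((V → ℝ) × ℝ) := (Metric.sphere 0 1 ×ˢ Set.Icc c (∑ p, A p)) ∩
    {q | (∀ j, 0 ≤ q.1 j) ∧ ∀ i, q.2 * q.1 i ^ (m - 1) ≤ A.applyOver q.1 i}
  have hK : IsCompact K := by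
    refine ((isCompact_sphere _ _).prod isCompact_Icc).inter_right ?_
    simp only [Set.ofPred_and, Set.ofPred_forall]
    refine (isClosed_iInter fun j => isClosed_le continuous_const (by fun_prop)).inter
      (isClosed_iInter fun i => isClosed_le (by fun_prop) ?_)
    exact (continuous_applyOver i).comp (continuous_const.prodMk continuous_fst)
  have hmem : ∀ (y : V → ℝ) (d : ℝ), c ≤ d → (∀ j, 0 ≤ y j) → y ≠ 0 →
      (∀ i, d * y i ^ (m - 1) ≤ A.applyOver y i) → ∃ z, (z, d) ∈ K := by
    intro y d hd hy hy0 hyd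
    obtain ⟨z, hz, hz1, hzd⟩ := normalize_subeigenvector hy hy0 hyd
    exact ⟨z, ⟨by simpa using hz1, hd, le_sum_of_subeigenvector hA' hz hz1 hzd⟩, hz, hzd⟩
  obtain ⟨z, hz⟩ := hmem x c le_rfl hx hx0 h
  obtain ⟨⟨y, d⟩, ⟨⟨hy1, hd⟩, hy, hyd⟩, hmax⟩ :=
    hK.exists_isMaxOn ⟨_, hz⟩ continuous_snd.continuousOn
  have hy0 : y ≠ 0 := by rintro rfl; simp at hy1
  refine ⟨d, hd.1, y, hy0, fun i => ?_⟩
  by_contra hne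
  obtain ⟨d', hd', y', hy', hy0', hyd'⟩ := exists_lt_subeigenvector hA hm hy hy0 (hc.trans hd.1)
    hyd ((hyd i).lt_of_ne' hne)
  obtain ⟨z', hz'⟩ := hmem y' d' (hd.1.trans hd'.le) hy' hy0' hyd'
  exact absurd (hmax hz') (not_le.2 hd')

/-- Collatz–Wielandt for nonnegative hypermatrices. -/
theorem exists_eigenvalue_ge [Nonempty V] {A : Hypermatrix V m} (hA : ∀ p, 0 ≤ A p)
    (hm : m - 1 ≠ 0) {x : V → ℝ} (hx : ∀ j, 0 ≤ x j) (hx0 : x ≠ 0) {c : ℝ} (hc : 0 ≤ c)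
    (h : ∀ i, c * x i ^ (m - 1) ≤ A.applyOver x i) :
    ∃ c' ≥ c, c' ∈ A.eigenvalueSet ℝ := by
  -- Perturb to the positive hypermatrix `A + ε`. The parameters `ε` admitting a normalised
  -- eigenpair in `T` form a closed set containing `(0, 1]`, hence `0`; bounding by the entries of
  -- `B 1` is uniform in `ε`.
  let B : ℝ → Hypermatrix V m := fun ε p => A p + ε
  have hB : Continuous B := by fun_prop
  let T : Set (ℝ × (V → ℝ) × ℝ) :=
    (Set.Icc 0 1 ×ˢ (Metric.sphere 0 1 ×ˢ Set.Icc c (∑ p, B 1 p))) ∩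
    {q | ∀ i, (B q.1).applyOver q.2.1 i = q.2.2 * q.2.1 i ^ (m - 1)}
  have hT : IsCompact T := by
    refine (isCompact_Icc.prod ((isCompact_sphere _ _).prod isCompact_Icc)).inter_right ?_
    simp only [Set.ofPred_forall]
    refine isClosed_iInter fun i => isClosed_eq ?_ (by fun_prop)
    exact (continuous_applyOver i).comp ((hB.comp continuous_fst).prodMk
      (continuous_fst.comp continuous_snd))
  have hsub : Set.Ioc (0 : ℝ) 1 ⊆ Prod.fst '' T := by
    rintro ε ⟨hε, hε1⟩
    have hle : ∀ i, c * x i ^ (m - 1) ≤ (B ε).applyOver x i := fun i =>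
      (h i).trans (Finset.sum_le_sum fun p _ => smul_le_smul_of_nonneg_right
        (le_add_of_nonneg_right hε.le) (Finset.prod_nonneg fun _ _ => hx _))
    have hBpos : ∀ p, 0 < B ε p := fun p => add_pos_of_nonneg_of_pos (hA p) hε
    obtain ⟨c', hc', hmem⟩ := exists_eigenvalue_ge_of_pos hBpos hm hx hx0 hc hle
    obtain ⟨y, hy1, hy⟩ := mem_eigenvalueSet_iff_norm_eq_one.1 hmem
    refine ⟨(ε, y, c'), ⟨⟨⟨hε.le, hε1⟩, by simpa using hy1, hc', ?_⟩, hy⟩, rfl⟩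
    obtain ⟨i, hi⟩ := exists_norm_eq y
    have h1 := (B ε).norm_applyOver_le (fun j => norm_le_pi_norm y j) i
    rw [hy i, norm_mul, norm_pow, hi, hy1, one_pow, mul_one, mul_one] at h1
    simp only [abs_of_pos (hBpos _)] at h1
    refine (le_abs_self c').trans (h1.trans ?_)
    refine (Finset.sum_le_sum_of_subset_of_nonneg (Finset.subset_univ _)
      fun p _ _ => (hBpos p).le).trans (Finset.sum_le_sum fun p _ => ?_)
    exact add_le_add_right hε1 _
  have h0 : (0 : ℝ) ∈ Prod.fst '' T := by
    have := closure_minimal hsub (hT.image continuous_fst).isClosed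
    rw [closure_Ioc zero_ne_one] at this
    exact this ⟨le_rfl, zero_le_one⟩
  obtain ⟨⟨ε, y, c'⟩, ⟨⟨-, hy1, hc'⟩, hy⟩, rfl⟩ := h0
  refine ⟨c', hc'.1, y, by rintro rfl; simp at hy1, fun i => ?_⟩
  have : B 0 = A := by simp [B]
  rw [← hy i, this]

end Hypermatrix

/-! ### Spectrum of the out-signless Laplacian. -/

namespace DirectedEdge

/-- A tuple of an edge of full size lists the vertices of the edge without repetition. -/
theorem Fits.prod_eq {V : Type*} [DecidableEq V] {e : DirectedEdge V} {m : ℕ}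
    {p : Fin m → V} (h : e.Fits p) (hm : #e.verts = m) {M : Type*} [CommMonoid M] (x : V → M) :
    ∏ j, x (p j) = ∏ v ∈ e.verts, x v := by
  obtain ⟨t, -, h1, h2⟩ := h
  have himg : univ.image p = e.verts := by
    rw [DirectedEdge.verts, ← h1, ← h2, ← Finset.image_union]
    congr 1
    ext j
    simpa using lt_or_ge _ _
  have hinj : Function.Injective p := by
    rw [← Set.injOn_univ, ← Finset.coe_univ, ← Finset.card_image_iff, himg, hm, card_univ,
      Fintype.card_fin]
  rw [← himg, Finset.prod_image hinj.injOn]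

end DirectedEdge

namespace DirectedHypergraph

open Hypermatrix

theorem IsUniform.eq_rank {V : Type*} [DecidableEq V] {H : DirectedHypergraph V} {m : ℕ}
    (hH : H.IsUniform m) (hE : H.edges.Nonempty) : m = H.rank := by
  obtain ⟨e, he⟩ := hE
  exact ((hH e he).symm.trans_le (H.card_verts_le_rank he)).antisymm
    (Finset.sup_le fun f hf => (hH f hf).le)

variable {V : Type*} [Fintype V] [DecidableEq V]
variable {𝕜 : Type*} [NormedField 𝕜] [NormedAlgebra ℝ 𝕜]

theorem applyOver_outDegreeHypermatrix (H : DirectedHypergraph V) {m : ℕ} (z : Fin m)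
    (x : V → 𝕜) (i : V) :
    (H.outDegreeHypermatrix m).applyOver x i = (H.outDegree i : 𝕜) * x i ^ (m - 1) := by
  rw [applyOver, Finset.sum_eq_single fun _ => i]
  · have h : H.outDegreeHypermatrix m (fun _ => i) = H.outDegree i := by
      rw [outDegreeHypermatrix, Finset.sum_eq_single i _ (by simp), if_pos fun _ => rfl]
      exact fun v _ hv => if_neg fun h => hv (h z).symm
    rw [h, Finset.prod_const, card_filter_val_ne_zero, Nat.cast_smul_eq_nsmul, nsmul_eq_mul]
  · intro p hp hne
    have h : H.outDegreeHypermatrix m p = 0 := by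
      refine Finset.sum_eq_zero fun v _ => if_neg fun hv => hne ?_
      have h0 : p ⟨0, z.pos⟩ = i := (Finset.mem_filter.1 hp).2 _ rfl
      funext j
      rw [hv j, ← hv ⟨0, z.pos⟩, h0]
    rw [h, zero_smul]
  · simp

theorem sum_outAdjacency_first (H : DirectedHypergraph V) (hE : H.edges.Nonempty) (i : V) :
    ∑ p : Fin H.rank → V with ∀ j : Fin H.rank, j.val = 0 → p j = i, H.outAdjacency H.rank p =
      H.outDegree i := by
  have hm := two_le_rank hE
  rw [← H.sum_outAdjacency (z := ⟨0, by omega⟩) rfl i]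
  refine Finset.sum_congr (Finset.filter_congr fun p _ => ?_) fun _ _ => rfl
  constructor
  · exact fun h => h _ rfl
  · rintro h ⟨j, hj⟩ rfl
    exact h

theorem norm_applyOver_outAdjacency_le (H : DirectedHypergraph V) (hE : H.edges.Nonempty)
    {x : V → 𝕜} {M : ℝ} (hx : ∀ j, ‖x j‖ ≤ M) (i : V) :
    ‖(H.outAdjacency H.rank).applyOver x i‖ ≤ H.outDegree i * M ^ (H.rank - 1) := by
  refine (norm_applyOver_le _ hx i).trans_eq ?_
  simp only [abs_of_nonneg (H.outAdjacency_nonneg _), H.sum_outAdjacency_first hE]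

theorem applyOver_outSignlessLaplacian (H : DirectedHypergraph V) (hE : H.edges.Nonempty)
    (x : V → 𝕜) (i : V) :
    H.outSignlessLaplacian.applyOver x i = (H.outDegree i : 𝕜) * x i ^ (H.rank - 1) +
      (H.outAdjacency H.rank).applyOver x i := by
  rw [outSignlessLaplacian, applyOver_add,
    H.applyOver_outDegreeHypermatrix ⟨0, by have := two_le_rank hE; omega⟩]

theorem outSignlessLaplacian_nonneg (H : DirectedHypergraph V) (p : Fin H.rank → V) :
    0 ≤ H.outSignlessLaplacian p :=
  add_nonneg (Finset.sum_nonneg fun _ _ => by split_ifs <;> positivity) (H.outAdjacency_nonneg p)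

/-- Gershgorin's theorem for the out-signless Laplacian. -/
theorem exists_norm_sub_outDegree_le [Nonempty V] {H : DirectedHypergraph V}
    (hE : H.edges.Nonempty) {c : 𝕜} (hc : c ∈ H.outSignlessLaplacian.eigenvalueSet 𝕜) :
    ∃ i, ‖c - H.outDegree i‖ ≤ H.outDegree i := by
  obtain ⟨x, hx1, hx⟩ := mem_eigenvalueSet_iff_norm_eq_one.1 hc
  obtain ⟨i, hi⟩ := exists_norm_eq x
  refine ⟨i, ?_⟩
  have h1 := H.norm_applyOver_outAdjacency_le hE (fun j => norm_le_pi_norm x j) i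
  have h2 := hx i
  rw [H.applyOver_outSignlessLaplacian hE, ← eq_sub_iff_add_eq', ← sub_mul] at h2
  rwa [h2, norm_mul, norm_pow, hi, hx1, one_pow, mul_one, mul_one] at h1

theorem outDegree_le_maxOutDegree [Nonempty V] (H : DirectedHypergraph V) (i : V) :
    H.outDegree i ≤ H.maxOutDegree :=
  Finset.le_sup' H.outDegree (mem_univ i)

theorem minOutDegree_le_outDegree [Nonempty V] (H : DirectedHypergraph V) (i : V) :
    H.minOutDegree ≤ H.outDegree i :=
  Finset.inf'_le H.outDegree (mem_univ i)

theorem norm_le_two_mul_maxOutDegree [Nonempty V] {H : DirectedHypergraph V}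
    (hE : H.edges.Nonempty) {c : 𝕜} (hc : c ∈ H.outSignlessLaplacian.eigenvalueSet 𝕜) :
    ‖c‖ ≤ 2 * H.maxOutDegree := by
  obtain ⟨i, hi⟩ := exists_norm_sub_outDegree_le hE hc
  have h1 : (H.outDegree i : ℝ) ≤ H.maxOutDegree := by
    exact_mod_cast H.outDegree_le_maxOutDegree i
  have h2 : ‖(H.outDegree i : 𝕜)‖ = H.outDegree i := by
    rw [← map_natCast (algebraMap ℝ 𝕜), norm_algebraMap', Real.norm_natCast]
  have h3 := norm_le_norm_sub_add c (H.outDegree i : 𝕜)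
  linarith

/-- Each Gershgorin disc has equal centre and radius, so it meets the real line only in nonnegative
numbers. -/
theorem nonneg_of_isEigenvalue [Nonempty V] {H : DirectedHypergraph V}
    (hE : H.edges.Nonempty) {c : ℝ} (hc : (c : ℂ) ∈ H.outSignlessLaplacian.eigenvalueSet ℂ) :
    0 ≤ c := by
  obtain ⟨i, hi⟩ := exists_norm_sub_outDegree_le hE hc
  rw [← Complex.ofReal_natCast, ← Complex.ofReal_sub, Complex.norm_real, Real.norm_eq_abs] at hi
  linarith [(abs_le.1 hi).1]

theorem applyOver_outAdjacency_one (H : DirectedHypergraph V) (hE : H.edges.Nonempty) (i : V) :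
    (H.outAdjacency H.rank).applyOver (1 : V → 𝕜) i = H.outDegree i := by
  rw [← map_natCast (algebraMap ℝ 𝕜), ← H.sum_outAdjacency_first hE i, applyOver, map_sum]
  simp [Algebra.algebraMap_eq_smul_one]

theorem applyOver_outSignlessLaplacian_one (H : DirectedHypergraph V) (hE : H.edges.Nonempty)
    (i : V) : H.outSignlessLaplacian.applyOver (1 : V → 𝕜) i = 2 * H.outDegree i := by
  rw [H.applyOver_outSignlessLaplacian hE, H.applyOver_outAdjacency_one hE, Pi.one_apply, one_pow,
    mul_one, two_mul]

theorem exists_eigenvalue_ge_two_mul_minOutDegree [Nonempty V] {H : DirectedHypergraph V}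
    (hE : H.edges.Nonempty) :
    ∃ c ≥ 2 * (H.minOutDegree : ℝ), c ∈ H.outSignlessLaplacian.eigenvalueSet ℝ := by
  have hm := two_le_rank hE
  refine exists_eigenvalue_ge H.outSignlessLaplacian_nonneg (by omega) (x := 1)
    (fun _ => zero_le_one) one_ne_zero (by positivity) fun i => ?_
  rw [H.applyOver_outSignlessLaplacian_one hE, Pi.one_apply, one_pow, mul_one]
  have : (H.minOutDegree : ℝ) ≤ H.outDegree i := by exact_mod_cast H.minOutDegree_le_outDegree i
  linarith

/-- The basis vector at `i` is always a subeigenvector, even when an edge with two vertices has head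
`{i}`: the adjacency part only adds nonnegative terms. -/
theorem exists_eigenvalue_ge_outDegree [Nonempty V] {H : DirectedHypergraph V}
    (hE : H.edges.Nonempty) (i : V) :
    ∃ c ≥ (H.outDegree i : ℝ), c ∈ H.outSignlessLaplacian.eigenvalueSet ℝ := by
  have hm := two_le_rank hE
  have hx : ∀ j, 0 ≤ (Pi.single i 1 : V → ℝ) j := fun j => by
    rw [Pi.single_apply]
    split_ifs <;> norm_num
  refine exists_eigenvalue_ge H.outSignlessLaplacian_nonneg (by omega) hx (by simp)
    (by positivity) fun j => ?_
  have h0 := applyOver_nonneg (A := H.outAdjacency H.rank) H.outAdjacency_nonneg hx j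
  rw [H.applyOver_outSignlessLaplacian hE]
  rcases eq_or_ne j i with rfl | hj
  · linarith
  · rw [Pi.single_eq_of_ne hj, zero_pow (by omega)] at *
    linarith

/-- A nonzero term has `i` in every position but the first. The head is then `{i}`, and the tail,
avoiding `i`, is only the first entry: a forbidden edge with two vertices. -/
theorem applyOver_outAdjacency_single (H : DirectedHypergraph V) (hE : H.edges.Nonempty) {i : V}
    (hi : H.NotTwoVertexHead i) (j : V) :
    (H.outAdjacency H.rank).applyOver (Pi.single i 1 : V → 𝕜) j = 0 := by
  refine Finset.sum_eq_zero fun p _ => ?_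
  by_contra hne
  obtain ⟨hA, hprod⟩ := smul_ne_zero_iff.1 hne
  obtain ⟨e, he, t, ht, h1, h2⟩ := exists_fits_of_outAdjacency_ne_zero hA
  have hp : ∀ l : Fin H.rank, (l : ℕ) ≠ 0 → p l = i := by
    intro l hl
    by_contra hpl
    refine hprod (Finset.prod_eq_zero (Finset.mem_filter.2 ⟨mem_univ l, hl⟩) ?_)
    rw [Pi.single_eq_of_ne hpl]
  have htail := e.card_tail_pos
  rw [mem_Icc] at ht
  have hhead : e.head = {i} := by
    refine Finset.eq_singleton_iff_nonempty_unique_mem.2 ⟨e.head_nonempty, fun v hv => ?_⟩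
    rw [← h2] at hv
    obtain ⟨l, hl, rfl⟩ := mem_image.1 hv
    refine hp l ?_
    have := (Finset.mem_filter.1 hl).2
    omega
  have hi_tail : i ∉ e.tail := fun h => Finset.disjoint_left.1 e.disjoint h (by simp [hhead])
  have htail1 : #e.tail ≤ 1 := by
    refine Finset.card_le_one.2 fun a ha b hb => ?_
    have key : ∀ a ∈ e.tail, ∀ l : Fin H.rank, (l : ℕ) = 0 → a = p l := by
      intro a ha l hl
      rw [← h1] at ha
      obtain ⟨l', hl', rfl⟩ := mem_image.1 ha
      have h0 : (l' : ℕ) = 0 := by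
        by_contra h0
        exact hi_tail (hp l' h0 ▸ h1 ▸ mem_image_of_mem p hl')
      rw [Fin.ext (h0.trans hl.symm)]
    have hm := two_le_rank hE
    rw [key a ha ⟨0, by omega⟩ rfl, key b hb ⟨0, by omega⟩ rfl]
  refine hi e he ?_ hhead
  rw [e.card_verts, hhead, card_singleton]
  omega

theorem applyOver_outSignlessLaplacian_single (H : DirectedHypergraph V) (hE : H.edges.Nonempty)
    {i : V} (hi : H.NotTwoVertexHead i) (j : V) :
    H.outSignlessLaplacian.applyOver (Pi.single i 1 : V → 𝕜) j =
      H.outDegree i * (Pi.single i 1 : V → 𝕜) j ^ (H.rank - 1) := by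
  have hm := two_le_rank hE
  rw [H.applyOver_outSignlessLaplacian hE, H.applyOver_outAdjacency_single hE hi, add_zero]
  rcases eq_or_ne j i with rfl | hj
  · rfl
  · rw [Pi.single_eq_of_ne hj, zero_pow (by omega), mul_zero, mul_zero]

theorem outDegree_mem_eigenvalueSet (H : DirectedHypergraph V) (hE : H.edges.Nonempty)
    {i : V} (hi : H.NotTwoVertexHead i) :
    (H.outDegree i : 𝕜) ∈ H.outSignlessLaplacian.eigenvalueSet 𝕜 :=
  ⟨Pi.single i 1, by simp, H.applyOver_outSignlessLaplacian_single hE hi⟩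

theorem zero_mem_eigenvalueSet {H : DirectedHypergraph V} (hE : H.edges.Nonempty)
    (hH : H.IsUniform H.rank) (heven : Even H.rank) {v : V} (hv : ∀ e ∈ H.edges, v ∈ e.verts) :
    (0 : 𝕜) ∈ H.outSignlessLaplacian.eigenvalueSet 𝕜 := by
  have hm := two_le_rank hE
  -- Every edge contains `v`, so `x` has product `-1` over each edge. As `x i * x i = 1`, removing
  -- the first entry `i` leaves `-x i`, and the adjacency part cancels the diagonal since `x i ^ (m
  -- - 1) = x i` for even `m`.
  let x : V → 𝕜 := fun i => if i = v then -1 else 1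
  have hsq : ∀ i, x i * x i = 1 := fun i => by simp only [x]; split_ifs <;> simp
  refine ⟨x, fun h0 => by simpa [h0] using hsq v, fun i => ?_⟩
  have hodd : x i ^ (H.rank - 1) = x i := by
    obtain ⟨k, hk⟩ := heven
    rw [show H.rank - 1 = 2 * (k - 1) + 1 by omega, pow_succ, pow_mul, sq, hsq, one_pow, one_mul]
  have hadj : (H.outAdjacency H.rank).applyOver x i =
      (H.outAdjacency H.rank).applyOver (1 : V → 𝕜) i * -x i := by
    rw [applyOver, applyOver, Finset.sum_mul]
    refine Finset.sum_congr rfl fun p hp => ?_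
    rw [smul_mul_assoc]
    by_cases hA : H.outAdjacency H.rank p = 0
    · rw [hA, zero_smul, zero_smul]
    obtain ⟨e, he, hfit⟩ := exists_fits_of_outAdjacency_ne_zero hA
    have hall := hfit.prod_eq (hH e he) x
    have hz : ({j : Fin H.rank | (j : ℕ) ≠ 0} : Finset _) = univ.erase ⟨0, by omega⟩ := by
      ext j
      simp [Fin.ext_iff]
    have hp0 : p ⟨0, by omega⟩ = i := (Finset.mem_filter.1 hp).2 _ rfl
    have hneg : ∏ u ∈ e.verts, x u = -1 := by simp [x, Finset.prod_ite_eq', hv e he]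
    rw [← Finset.prod_erase_mul _ _ (mem_univ (⟨0, by omega⟩ : Fin H.rank)), ← hz, hp0, hneg] at hall
    simp only [Pi.one_apply, Finset.prod_const_one, one_mul]
    congr 1
    rw [← mul_one (∏ j : Fin H.rank with _, _), ← hsq i, ← mul_assoc, hall, neg_one_mul]
  rw [H.applyOver_outSignlessLaplacian hE, hadj, H.applyOver_outAdjacency_one hE, hodd]
  ring

theorem isGreatest_spectralRadius [Nonempty V] {H : DirectedHypergraph V}
    (hE : H.edges.Nonempty) :
    IsGreatest H.outSignlessLaplacian.eigenvalueModuli H.outSignlessLaplacian.spectralRadius := by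
  have h : H.outSignlessLaplacian.eigenvalueModuli =
      norm '' H.outSignlessLaplacian.eigenvalueSet ℂ := by
    ext r
    simp only [eigenvalueModuli, isEigenvalue_iff, Set.mem_ofPred_eq, Set.mem_image, eq_comm]
  obtain ⟨c, -, hc⟩ := exists_eigenvalue_ge_two_mul_minOutDegree hE
  rw [Hypermatrix.spectralRadius, h]
  exact ((isCompact_eigenvalueSet _).image continuous_norm).isGreatest_sSup
    ⟨_, _, ofReal_mem_eigenvalueSet hc, rfl⟩

/-- Sandwiching `S` between the H-eigenvalues and the real eigenvalues treats both sets at once: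
lower bounds on `lmax` and the upper bound on `lmin` use real eigenvectors, the others hold for
complex ones. -/
theorem exists_isLeast_isGreatest [Nonempty V] {H : DirectedHypergraph V}
    (hE : H.edges.Nonempty) {S : Set ℝ} (hS : IsCompact S)
    (hsub : H.outSignlessLaplacian.eigenvalueSet ℝ ⊆ S)
    (hsup : S ⊆ {c : ℝ | (c : ℂ) ∈ H.outSignlessLaplacian.eigenvalueSet ℂ}) :
    ∃ lmin lmax : ℝ, IsLeast S lmin ∧ IsGreatest S lmax ∧ 0 ≤ lmin ∧
      ((∃ i : V, H.outDegree i = H.minOutDegree ∧ H.NotTwoVertexHead i) →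
        lmin ≤ (H.minOutDegree : ℝ)) ∧
      (H.minOutDegree : ℝ) ≤ (H.maxOutDegree : ℝ) ∧
      (H.maxOutDegree : ℝ) ≤ lmax ∧ lmax ≤ 2 * (H.maxOutDegree : ℝ) := by
  obtain ⟨i, -, hi⟩ := Finset.exists_mem_eq_sup' Finset.univ_nonempty H.outDegree
  obtain ⟨c, hc, hmem⟩ := exists_eigenvalue_ge_outDegree hE i
  obtain ⟨lmin, hmin⟩ := hS.exists_isLeast ⟨c, hsub hmem⟩
  obtain ⟨lmax, hmax⟩ := hS.exists_isGreatest ⟨c, hsub hmem⟩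
  refine ⟨lmin, lmax, hmin, hmax, nonneg_of_isEigenvalue hE (hsup hmin.1), ?_, ?_, ?_, ?_⟩
  · rintro ⟨j, hj, hhead⟩
    rw [← hj]
    exact hmin.2 (hsub (H.outDegree_mem_eigenvalueSet hE hhead))
  · exact_mod_cast (H.minOutDegree_le_outDegree i).trans (H.outDegree_le_maxOutDegree i)
  · rw [maxOutDegree, hi]
    exact hc.le.trans (hmax.2 (hsub hmem))
  · have := norm_le_two_mul_maxOutDegree hE (hsup hmax.1)
    rw [Complex.norm_real] at this
    exact (le_abs_self _).trans this

end DirectedHypergraph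

theorem mainTheorem4 {V : Type*} [Fintype V] [DecidableEq V] [Nonempty V]
    (H : DirectedHypergraph V) (hE : H.edges.Nonempty) :
    -- (i)
    (3 ≤ H.rank → ∀ i : V, H.NotTwoVertexHead i →
      H.outSignlessLaplacian.IsEigenpair (H.outDegree i : ℂ) (Pi.single i 1)) ∧
    -- (ii)
    (IsGreatest H.outSignlessLaplacian.eigenvalueModuli H.outSignlessLaplacian.spectralRadius ∧
      2 * (H.minOutDegree : ℝ) ≤ H.outSignlessLaplacian.spectralRadius ∧
      H.outSignlessLaplacian.spectralRadius ≤ 2 * (H.maxOutDegree : ℝ)) ∧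
    -- (iii), for the set of all real eigenvalues and for the set of all H-eigenvalues
    (3 ≤ H.rank →
      ∀ S : Set ℝ, (S = {c : ℝ | H.outSignlessLaplacian.IsEigenvalue (c : ℂ)} ∨
          S = {c : ℝ | H.outSignlessLaplacian.IsHEigenvalue c}) →
        ∃ lmin lmax : ℝ, IsLeast S lmin ∧ IsGreatest S lmax ∧
          0 ≤ lmin ∧
          ((∃ i : V, H.outDegree i = H.minOutDegree ∧ H.NotTwoVertexHead i) →
            lmin ≤ (H.minOutDegree : ℝ)) ∧
          (H.minOutDegree : ℝ) ≤ (H.maxOutDegree : ℝ) ∧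
          (H.maxOutDegree : ℝ) ≤ lmax ∧
          lmax ≤ 2 * (H.maxOutDegree : ℝ)) ∧
    -- (iv)
    (∀ m : ℕ, H.IsUniform m → Even m → (∃ v : V, ∀ e ∈ H.edges, v ∈ e.verts) →
      H.outSignlessLaplacian.IsEigenvalue 0) ∧
    -- (v)
    (∀ k : ℕ, H.IsOutRegular k → H.outSignlessLaplacian.IsEigenvalue (2 * (k : ℂ))) := by
  have hm := DirectedHypergraph.two_le_rank hE
  refine ⟨fun _ i hi => ⟨by simp, fun j => ?_⟩,
    ⟨DirectedHypergraph.isGreatest_spectralRadius hE, ?_, ?_⟩, ?_, ?_, ?_⟩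
  · rw [← Hypermatrix.applyOver_complex]
    exact H.applyOver_outSignlessLaplacian_single hE hi j
  · obtain ⟨c, hc, hmem⟩ := DirectedHypergraph.exists_eigenvalue_ge_two_mul_minOutDegree hE
    refine hc.le.trans ((le_abs_self c).trans
      ((DirectedHypergraph.isGreatest_spectralRadius hE).2 ⟨c, ?_, ?_⟩))
    · exact (Hypermatrix.isEigenvalue_iff _ _).2 (Hypermatrix.ofReal_mem_eigenvalueSet hmem)
    · rw [Complex.norm_real, Real.norm_eq_abs]
  · obtain ⟨c, hc, heq⟩ := (DirectedHypergraph.isGreatest_spectralRadius hE).1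
    rw [heq]
    exact DirectedHypergraph.norm_le_two_mul_maxOutDegree hE
      ((Hypermatrix.isEigenvalue_iff _ _).1 hc)
  · rintro - S (rfl | rfl)
    · simp only [Hypermatrix.isEigenvalue_iff]
      refine DirectedHypergraph.exists_isLeast_isGreatest hE ?_
        (fun c hc => Hypermatrix.ofReal_mem_eigenvalueSet hc) le_rfl
      -- The real eigenvalues are the preimage of the compact complex eigenvalue set under the
      -- closed embedding `ℝ → ℂ`.
      exact Complex.isometry_ofReal.isClosedEmbedding.isCompact_preimage
        (Hypermatrix.isCompact_eigenvalueSet _)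
    · simp only [Hypermatrix.isHEigenvalue_iff]
      exact DirectedHypergraph.exists_isLeast_isGreatest hE
        (Hypermatrix.isCompact_eigenvalueSet _) le_rfl
        fun c hc => Hypermatrix.ofReal_mem_eigenvalueSet hc
  · rintro m hH heven ⟨v, hv⟩
    obtain rfl := hH.eq_rank hE
    exact (Hypermatrix.isEigenvalue_iff _ _).2
      (DirectedHypergraph.zero_mem_eigenvalueSet hE hH heven hv)
  · intro k hk
    refine (Hypermatrix.isEigenvalue_iff _ _).2 ⟨1, one_ne_zero, fun i => ?_⟩
    rw [H.applyOver_outSignlessLaplacian_one hE, hk i, Pi.one_apply, one_pow, mul_one]
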